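/- Let $A\in\mathbb R^{n\times n}$, $B\in\mathbb R^{n\times m}$, and let $F\in\mathbb R^{r\times n}$ have full row rank $r$. Consider the system $\dot x(t)=Ax(t)+Bu(t)$ on $[t_0,\infty)$ under the control law $u(t)=-ZFx(t)$ with a constant gain $Z\in\mathbb R^{m\times r}$. For $M\in\mathbb R^{r\times r}$, say that $Z$ yields the order-$r$ subsystem $M$ if every closed-loop solution (for every $t_0$ and every initial state) satisfies $\frac{d}{dt}(Fx)(t)=M\,Fx(t)$ for all $t\ge t_0$; its poles are the $r$ complex eigenvalues of $M$, counted with algebraic multiplicity. Consider the conditions $$\text{(a)}\quad \operatorname{rank}\begin{pmatrix}FA\\F\end{pmatrix}=\operatorname{rank}F,\qquad\qquad \text{(b)}\quad \operatorname{rank}\begin{pmatrix}sF-FA & FB\end{pmatrix}=\operatorname{rank}F\ \text{ for all } s\in\mathbb C .$$ 1. The control law can drive $Fx(t)\to 0$ at an arbitrary rate from any initial condition by placing the $r$ poles of a subsystem of order $r$ if and only if (a) and (b) hold. Here the first property means: for every $\rho>0$ there is a gain $Z$ that yields an order-$r$ subsystem $M$ all of whose poles have real part less than $-\rho$, and there is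 a constant $K$ such that every closed-loop solution satisfies $Fx(t)\to0$ as $t\to\infty$ and $\|Fx(t)\|\le K e^{-\rho(t-t_0)}\|Fx(t_0)\|$ for all $t\ge t_0$. 2. Likewise, (a) and (b) hold if and only if the $r$ poles can be placed arbitrarily: for every multiset $\Lambda$ of $r$ complex numbers that is invariant under complex conjugation there is a gain $Z$ that yields an order-$r$ subsystem $M$ whose poles are exactly $\Lambda$. 3. If (a) holds, then for every generalised inverse $F^-$ of $F$ (that is, every $F^-\in\mathbb R^{n\times r}$ with $FF^-F=F$) and every gain $Z$, every closed-loop solution satisfies $\frac{d}{dt}(Fx)(t)=(FAF^--FBZ)\,Fx(t)$ for all $t\ge t_0$. -/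

import Mathlib

open Matrix Filter Topology

namespace TargetOutput

/-- `x` solves `x' = A x + B u` on `[t₀, ∞)` (one-sided derivative at `t₀`). -/
def IsSolution {n m : ℕ} (A : Matrix (Fin n) (Fin n) ℝ) (B : Matrix (Fin n) (Fin m) ℝ)
    (u : ℝ → Fin m → ℝ) (t₀ : ℝ) (x : ℝ → Fin n → ℝ) : Prop :=
  ∀ t ∈ Set.Ici t₀, HasDerivWithinAt x (A *ᵥ x t + B *ᵥ u t) (Set.Ici t₀) t

/-- `x` solves `x' = A x + B u` on `[t₀, ∞)` under the control law `u = -Z F x`. -/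
def IsClosedLoopSolution {n m r : ℕ} (A : Matrix (Fin n) (Fin n) ℝ)
    (B : Matrix (Fin n) (Fin m) ℝ) (F : Matrix (Fin r) (Fin n) ℝ)
    (Z : Matrix (Fin m) (Fin r) ℝ) (t₀ : ℝ) (x : ℝ → Fin n → ℝ) : Prop :=
  IsSolution A B (fun t => -(Z *ᵥ (F *ᵥ x t))) t₀ x

/-- Under `u = -Z F x`, the target output `z = F x` is the state of the autonomous subsystem
`z' = M z` of order `r`: every closed-loop solution satisfies `(F x)' = M (F x)`. -/
def IsClosedLoopSubsystem {n m r : ℕ} (A : Matrix (Fin n) (Fin n) ℝ)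
    (B : Matrix (Fin n) (Fin m) ℝ) (F : Matrix (Fin r) (Fin n) ℝ)
    (Z : Matrix (Fin m) (Fin r) ℝ) (M : Matrix (Fin r) (Fin r) ℝ) : Prop :=
  ∀ (t₀ : ℝ) (x : ℝ → Fin n → ℝ), IsClosedLoopSolution A B F Z t₀ x →
    ∀ t ∈ Set.Ici t₀,
      HasDerivWithinAt (fun τ => F *ᵥ x τ) (M *ᵥ (F *ᵥ x t)) (Set.Ici t₀) t

/-- The poles of `z' = M z`: the complex eigenvalues of `M`, with algebraic multiplicity. -/
noncomputable def poles {r : ℕ} (M : Matrix (Fin r) (Fin r) ℝ) : Multiset ℂ :=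
  (M.map Complex.ofReal).charpoly.roots

/-- Under `u = -Z F x`, the target output `F x` tends to zero with exponential rate `ρ`
from every initial condition. -/
def ConvergesAtRate {n m r : ℕ} (A : Matrix (Fin n) (Fin n) ℝ)
    (B : Matrix (Fin n) (Fin m) ℝ) (F : Matrix (Fin r) (Fin n) ℝ)
    (Z : Matrix (Fin m) (Fin r) ℝ) (ρ : ℝ) : Prop :=
  ∃ K : ℝ, ∀ (t₀ : ℝ) (x : ℝ → Fin n → ℝ), IsClosedLoopSolution A B F Z t₀ x →
    Tendsto (fun t => F *ᵥ x t) atTop (𝓝 0) ∧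
    ∀ t ∈ Set.Ici t₀, ‖F *ᵥ x t‖ ≤ K * Real.exp (-ρ * (t - t₀)) * ‖F *ᵥ x t₀‖

/-- The control law `u = -Z F x` can drive `F x` to zero at an arbitrary rate by placing the
`r` poles of a subsystem of order `r`: for every `ρ > 0` some gain `Z` makes `F x` the state of
an autonomous subsystem of order `r` with all its poles to the left of `-ρ`, and makes `F x`
converge to zero with rate `ρ` from every initial condition. -/
def DrivesAtArbitraryRate {n m r : ℕ} (A : Matrix (Fin n) (Fin n) ℝ)
    (B : Matrix (Fin n) (Fin m) ℝ) (F : Matrix (Fin r) (Fin n) ℝ) : Prop :=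
  ∀ ρ : ℝ, 0 < ρ → ∃ (Z : Matrix (Fin m) (Fin r) ℝ) (M : Matrix (Fin r) (Fin r) ℝ),
    IsClosedLoopSubsystem A B F Z M ∧ (∀ μ ∈ poles M, μ.re < -ρ) ∧ ConvergesAtRate A B F Z ρ

/-- The `r` poles of the subsystem of order `r` with state `F x` can be placed by `u = -Z F x`
at every list of `r` complex numbers that is symmetric under conjugation. -/
def PolesPlaceable {n m r : ℕ} (A : Matrix (Fin n) (Fin n) ℝ)
    (B : Matrix (Fin n) (Fin m) ℝ) (F : Matrix (Fin r) (Fin n) ℝ) : Prop :=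
  ∀ Λ : Multiset ℂ, Multiset.card Λ = r → Λ.map (starRingEnd ℂ) = Λ →
    ∃ (Z : Matrix (Fin m) (Fin r) ℝ) (M : Matrix (Fin r) (Fin r) ℝ),
      IsClosedLoopSubsystem A B F Z M ∧ poles M = Λ

/-- `rank [FA; F] = rank F`. -/
def InvarianceRankCondition {n r : ℕ} (A : Matrix (Fin n) (Fin n) ℝ)
    (F : Matrix (Fin r) (Fin n) ℝ) : Prop :=
  (Matrix.fromRows (F * A) F).rank = F.rank

/-- `rank [sF - FA, FB] = rank F` for all complex `s`. -/
def PencilRankCondition {n m r : ℕ} (A : Matrix (Fin n) (Fin n) ℝ)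
    (B : Matrix (Fin n) (Fin m) ℝ) (F : Matrix (Fin r) (Fin n) ℝ) : Prop :=
  ∀ s : ℂ, (Matrix.fromCols (s • F.map Complex.ofReal - (F * A).map Complex.ofReal)
    ((F * B).map Complex.ofReal)).rank = F.rank

end TargetOutput

/-! Since every state is an initial state, comparing derivatives at time 0 shows that `Z` yields `M`
iff `F * A = (M + F * B * Z) * F` (`isClosedLoopSubsystem_iff`). So a subsystem exists iff `F * A =
N * F` for some `N`, which is (a). Full row rank makes `N` unique, hence `M = N - F * B * Z`: the
question is pole placement for the pair `(N, F * B)`.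

As `s F - F A = (s I - N) F`, condition (b) is Hautus' test: no nonzero left eigenvector of `N`
kills `F * B`. Such a vector would survive every feedback and fix a pole, so it suffices for
necessity that each `s` is avoided by some gain. Conversely, the test gives controllability
(`eq_top_of_hautus`), and Heymann's lemma with Ackermann's formula assigns any real monic
characteristic polynomial of degree `r`. Distinct real poles give the decay estimate. -/

namespace TargetOutput

/-! ### Pole placement over a field -/

section PolePlacement

open Polynomial Module

variable {𝕜 U V : Type*} [Field 𝕜] [AddCommGroup U] [Module 𝕜 U] [AddCommGroup V] [Module 𝕜 V]

/-- A polynomial of degree at most `k` annihilating a covector `q` with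
`q (T ^ i b) = 0` for `i < k` and `q (T ^ k b) = 1` vanishes. -/
theorem eq_zero_of_covector_aeval_eq_zero {T : End 𝕜 V} {b : V} {q : Dual 𝕜 V} {k : ℕ}
    (hq : ∀ i < k, q ((T ^ i) b) = 0) (hk : q ((T ^ k) b) = 1) {h : 𝕜[X]}
    (hdeg : h.natDegree ≤ k) (hh : ∀ v, q (aeval T h v) = 0) : h = 0 := by
  -- On this vector `q` sees only the leading term of `h`, which lands on `T ^ k b`.
  have h1 := hh ((T ^ (k - h.natDegree)) b)
  rw [aeval_eq_sum_range, LinearMap.sum_apply, map_sum, Finset.sum_range_succ,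
    Finset.sum_eq_zero] at h1
  · rw [LinearMap.smul_apply, ← Module.End.mul_apply, ← pow_add, Nat.add_sub_cancel' hdeg,
      map_smul, hk] at h1
    simpa using h1
  · intro i hi
    rw [LinearMap.smul_apply, ← Module.End.mul_apply, ← pow_add, map_smul, hq, smul_zero]
    have := Finset.mem_range.1 hi
    omega

/-- Single-input pole placement by Ackermann's formula. -/
theorem exists_charpoly_sub_smulRight_eq [FiniteDimensional 𝕜 V] {T : End 𝕜 V} {b : V} {r : ℕ}
    (hr : finrank 𝕜 V = r) (hb : LinearIndependent 𝕜 (fun i : Fin r => (T ^ (i : ℕ)) b))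
    {p : 𝕜[X]} (hp : p.Monic) (hpr : p.natDegree = r) :
    ∃ f : Dual 𝕜 V, (T - f.smulRight b).charpoly = p := by
  rcases r with _ | k
  · refine ⟨0, ?_⟩
    rw [hp.natDegree_eq_zero.1 hpr]
    exact (LinearMap.charpoly_monic _).natDegree_eq_zero.1 (by rw [LinearMap.charpoly_natDegree, hr])
  let e := basisOfLinearIndependentOfCardEqFinrank hb (by simp [hr])
  have he : ∀ i, e i = (T ^ (i : ℕ)) b := fun i => by simp [e]
  let q : Dual 𝕜 V := e.coord (Fin.last k)
  have hq : ∀ i < k, q ((T ^ i) b) = 0 := fun i hi => by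
    have := he ⟨i, by omega⟩
    simp only at this
    rw [← this, Basis.coord_apply, Basis.repr_self, Finsupp.single_apply, if_neg]
    simp [Fin.ext_iff, hi.ne]
  have hk : q ((T ^ k) b) = 1 := by
    have := he (Fin.last k)
    simp only [Fin.val_last] at this
    rw [← this, Basis.coord_apply, Basis.repr_self, Finsupp.single_eq_same]
  -- Ackermann's choice: below degree `k + 1` the feedback is invisible to `q`, and in degree `k +
  -- 1` it subtracts exactly `f`, so `q ∘ p(M) = 0`.
  let f : Dual 𝕜 V := q ∘ₗ aeval T p
  let M := T - f.smulRight b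
  have hM : ∀ i ≤ k, ∀ v, q ((M ^ i) v) = q ((T ^ i) v) := by
    intro i
    induction i with
    | zero => simp
    | succ i ih =>
      intro hi v
      rw [pow_succ, Module.End.mul_apply, ih (by omega), pow_succ, Module.End.mul_apply]
      simp [M, hq i (by omega)]
  have hMk : ∀ v, q ((M ^ (k + 1)) v) = q ((T ^ (k + 1)) v) - f v := by
    intro v
    rw [pow_succ, Module.End.mul_apply, hM k le_rfl, pow_succ, Module.End.mul_apply]
    simp [M, hk]
  have hlow : ∀ h : 𝕜[X], h.natDegree ≤ k → ∀ v, q (aeval M h v) = q (aeval T h v) := by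
    intro h hh v
    simp only [aeval_eq_sum_range, LinearMap.sum_apply, map_sum, LinearMap.smul_apply, map_smul]
    refine Finset.sum_congr rfl fun i hi => ?_
    rw [hM i (by have := Finset.mem_range.1 hi; omega)]
  have hpM : ∀ v, q (aeval M p v) = 0 := by
    intro v
    have h1 : q (aeval M p v) = q (aeval T p v) - f v := by
      simp only [aeval_eq_sum_range, LinearMap.sum_apply, map_sum, LinearMap.smul_apply, map_smul]
      rw [hpr, Finset.sum_range_succ, Finset.sum_range_succ _ (k + 1), hMk]
      have hc : p.coeff (k + 1) = 1 := by rw [← hpr]; exact hp.coeff_natDegree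
      rw [hc, one_smul, one_smul, add_sub_assoc]
      congr 1
      refine Finset.sum_congr rfl fun i hi => ?_
      rw [hM i (by have := Finset.mem_range.1 hi; omega)]
    rw [h1]
    simp [f]
  refine ⟨f, ?_⟩
  change M.charpoly = p
  have hcm := LinearMap.charpoly_monic M
  have hcd : M.charpoly.natDegree = k + 1 := by rw [LinearMap.charpoly_natDegree, hr]
  have hd : (M.charpoly - p).natDegree ≤ k := by
    have hlt : (M.charpoly - p).degree < M.charpoly.degree := by
      refine degree_sub_lt_left ?_ hcm.ne_zero ?_
      · rw [degree_eq_natDegree hcm.ne_zero, degree_eq_natDegree hp.ne_zero, hcd, hpr]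
      · rw [hcm.leadingCoeff, hp.leadingCoeff]
    rw [degree_eq_natDegree hcm.ne_zero, hcd] at hlt
    rw [← Nat.lt_succ_iff]
    rcases eq_or_ne (M.charpoly - p) 0 with h0 | h0
    · simp [h0]
    · exact (natDegree_lt_iff_degree_lt h0).2 hlt
  -- By Cayley–Hamilton `q` also kills `M.charpoly` at `M`; the difference has degree at most `k`,
  -- where `M` may be replaced by `T`.
  refine sub_eq_zero.1 (eq_zero_of_covector_aeval_eq_zero hq hk hd fun v => ?_)
  rw [← hlow _ hd, map_sub, LinearMap.sub_apply, map_sub, hpM, LinearMap.aeval_self_charpoly]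
  simp

/-- A controllable pair admits an input sequence whose states are linearly independent. -/
theorem exists_linearIndependent_trajectory [FiniteDimensional 𝕜 V] {N : End 𝕜 V} {G : U →ₗ[𝕜] V}
    (hc : ∀ W : Submodule 𝕜 V, (∀ w ∈ W, N w ∈ W) → (∀ u, G u ∈ W) → W = ⊤) :
    ∀ k ≤ finrank 𝕜 V, ∃ (x : ℕ → V) (u : ℕ → U), x 0 = 0 ∧
      (∀ i < k, x (i + 1) = N (x i) + G (u i)) ∧
      LinearIndependent 𝕜 (fun i : Fin k => x (i + 1)) := by
  intro k
  induction k with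
  | zero => exact fun _ => ⟨0, 0, rfl, by simp, linearIndependent_empty_type⟩
  | succ k ih =>
    intro hk
    obtain ⟨x, u, h0, hx, hli⟩ := ih (by omega)
    let W := Submodule.span 𝕜 (Set.range fun i : Fin k => x (i + 1))
    have hmem : ∀ i ≤ k, x i ∈ W := by
      rintro (_ | i) hi
      · rw [h0]; exact W.zero_mem
      · exact Submodule.subset_span ⟨⟨i, hi⟩, rfl⟩
    -- Otherwise `W` contains `N (x k)` and the range of `G`, hence is `N`-invariant by the
    -- recursion, and must be everything despite having dimension `k`.
    obtain ⟨a, ha⟩ : ∃ a, N (x k) + G a ∉ W := by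
      by_contra! hW
      have hN : N (x k) ∈ W := by simpa using hW 0
      have hG : ∀ a, G a ∈ W := fun a => (W.add_mem_iff_right hN).1 (hW a)
      have htop : W = ⊤ := by
        refine hc W (fun w hw => ?_) hG
        refine Submodule.span_induction (p := fun w _ => N w ∈ W) ?_ (by simp)
          (fun _ _ _ _ h1 h2 => by rw [map_add]; exact W.add_mem h1 h2)
          (fun c _ _ h1 => by rw [map_smul]; exact W.smul_mem c h1) hw
        rintro _ ⟨i, rfl⟩
        rcases (Nat.succ_le_of_lt i.2).lt_or_eq with hi | hi
        · have := hx (i + 1) hi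
          have h2 := hmem (i + 1 + 1) hi
          rw [this] at h2
          exact (W.add_mem_iff_left (hG _)).1 h2
        · simp only [Nat.succ_eq_add_one] at hi
          simpa only [hi] using hN
      have h1 : finrank 𝕜 W = k := by simpa using finrank_span_eq_card hli
      rw [htop, finrank_top] at h1
      omega
    refine ⟨Function.update x (k + 1) (N (x k) + G a), Function.update u k a, ?_, ?_, ?_⟩
    · simpa using h0
    · intro i hi
      rcases (Nat.lt_succ_iff.1 hi).lt_or_eq with hi | rfl
      · rw [Function.update_of_ne (by omega), Function.update_of_ne (by omega),
          Function.update_of_ne (by omega), hx i hi]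
      · rw [Function.update_self, Function.update_of_ne (by omega), Function.update_self]
    · have := hli.finSnoc ha
      convert this using 1
      funext i
      refine Fin.lastCases ?_ (fun j => ?_) i
      · simp
      · rw [Fin.snoc_castSucc, Function.update_of_ne]
        · simp
        · have := j.2
          simp only [Fin.val_castSucc]
          omega

/-- Heymann's lemma: state feedback makes a controllable pair cyclic from a single input. -/
theorem exists_feedback_cyclic [FiniteDimensional 𝕜 V] {N : End 𝕜 V} {G : U →ₗ[𝕜] V}
    (hc : ∀ W : Submodule 𝕜 V, (∀ w ∈ W, N w ∈ W) → (∀ u, G u ∈ W) → W = ⊤) :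
    ∃ (K : V →ₗ[𝕜] U) (a : U),
      LinearIndependent 𝕜 (fun i : Fin (finrank 𝕜 V) => ((N + G ∘ₗ K) ^ (i : ℕ)) (G a)) := by
  obtain ⟨x, u, h0, hx, hli⟩ := exists_linearIndependent_trajectory hc _ le_rfl
  let e := basisOfLinearIndependentOfCardEqFinrank' _ hli (by simp)
  have he : ∀ i, e i = x (i + 1) := fun i => by simp [e]
  -- Feedback replays the open-loop inputs; the shift reflects `x 1 = G (u 0)`. The value at the
  -- last basis vector is immaterial.
  let K : V →ₗ[𝕜] U := e.constr 𝕜 fun i => u (i + 1)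
  have hK : ∀ i < finrank 𝕜 V, K (x (i + 1)) = u (i + 1) := fun i hi => by
    rw [← he ⟨i, hi⟩, Basis.constr_basis]
  refine ⟨K, u 0, ?_⟩
  convert hli using 2 with i
  obtain ⟨i, hi⟩ := i
  simp only
  induction i with
  | zero => simp [hx 0 hi, h0]
  | succ i ih =>
    rw [pow_succ', Module.End.mul_apply, ih (by omega), hx (i + 1) hi]
    simp [hK i (by omega)]

/-- Pole placement: over any field, the characteristic polynomial of a controllable pair can be
assigned by state feedback. -/
theorem exists_charpoly_sub_comp_eq [FiniteDimensional 𝕜 V] {N : End 𝕜 V} {G : U →ₗ[𝕜] V}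
    (hc : ∀ W : Submodule 𝕜 V, (∀ w ∈ W, N w ∈ W) → (∀ u, G u ∈ W) → W = ⊤)
    {p : 𝕜[X]} (hp : p.Monic) (hpr : p.natDegree = finrank 𝕜 V) :
    ∃ K : V →ₗ[𝕜] U, (N - G ∘ₗ K).charpoly = p := by
  obtain ⟨K, a, hli⟩ := exists_feedback_cyclic hc
  obtain ⟨f, hf⟩ := exists_charpoly_sub_smulRight_eq rfl hli hp hpr
  refine ⟨f.smulRight a - K, ?_⟩
  rw [← hf]
  congr 1
  ext v
  simp only [LinearMap.sub_apply, LinearMap.add_apply, LinearMap.comp_apply,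
    LinearMap.smulRight_apply, map_sub, map_smul]
  abel

/-- Matrix form of pole placement. -/
theorem exists_charpoly_sub_mul_eq {r m : ℕ} {N : Matrix (Fin r) (Fin r) 𝕜}
    {G : Matrix (Fin r) (Fin m) 𝕜}
    (hc : ∀ W : Submodule 𝕜 (Fin r → 𝕜), (∀ w ∈ W, N *ᵥ w ∈ W) → (∀ u, G *ᵥ u ∈ W) → W = ⊤)
    {p : 𝕜[X]} (hp : p.Monic) (hpr : p.natDegree = r) :
    ∃ Z : Matrix (Fin m) (Fin r) 𝕜, (N - G * Z).charpoly = p := by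
  obtain ⟨K, hK⟩ := exists_charpoly_sub_comp_eq (N := Matrix.toLin' N) (G := Matrix.toLin' G)
    (by simpa using hc) hp (by simpa using hpr)
  refine ⟨LinearMap.toMatrix' K, ?_⟩
  rw [← hK, ← LinearMap.charpoly_toMatrix _ (Pi.basisFun 𝕜 (Fin r)), 
    LinearMap.toMatrix_eq_toMatrix']
  congr 1
  rw [map_sub, LinearMap.toMatrix'_comp, LinearMap.toMatrix'_toLin', LinearMap.toMatrix'_toLin']

end PolePlacement

/-! ### Full row rank -/

section Rank

variable {𝕜 : Type*} [Field 𝕜]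

theorem rank_eq_iff_vecMul_injective {r : ℕ} {ι : Type*} [Fintype ι] (M : Matrix (Fin r) ι 𝕜) :
    M.rank = r ↔ ∀ v, v ᵥ* M = 0 → v = 0 := by
  rw [Matrix.rank_eq_finrank_span_row, ← Set.finrank, eq_comm]
  have := linearIndependent_iff_card_eq_finrank_span (R := 𝕜) (b := M.row)
  rw [Fintype.card_fin] at this
  rw [← this, ← Matrix.vecMul_injective_iff, ← Matrix.coe_vecMulLinear, ← LinearMap.ker_eq_bot,
    LinearMap.ker_eq_bot']
  rfl

theorem exists_right_inverse_of_rank_eq {r n : ℕ} {F : Matrix (Fin r) (Fin n) 𝕜}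
    (hF : F.rank = r) : ∃ R : Matrix (Fin n) (Fin r) 𝕜, F * R = 1 := by
  rw [← Matrix.mulVec_surjective_iff_exists_right_inverse, ← Matrix.coe_mulVecLin,
    ← LinearMap.range_eq_top]
  apply Submodule.eq_top_of_finrank_eq
  rw [← Matrix.rank, hF, Module.finrank_fin_fun]

end Rank

/-! ### The two rank conditions -/

variable {n m r : ℕ} {A : Matrix (Fin n) (Fin n) ℝ} {B : Matrix (Fin n) (Fin m) ℝ}
  {F : Matrix (Fin r) (Fin n) ℝ}

/-- Appending rows preserves the rank exactly when they lie in the old row space; their coefficients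
form `N`. -/
theorem invarianceRankCondition_iff :
    InvarianceRankCondition A F ↔ ∃ N : Matrix (Fin r) (Fin r) ℝ, F * A = N * F := by
  constructor
  · intro h
    rw [InvarianceRankCondition, Matrix.rank_eq_finrank_span_row,
      Matrix.rank_eq_finrank_span_row] at h
    have hle : Submodule.span ℝ (Set.range F.row) ≤
        Submodule.span ℝ (Set.range (Matrix.fromRows (F * A) F).row) := by
      refine Submodule.span_mono ?_
      rintro _ ⟨i, rfl⟩
      exact ⟨Sum.inr i, rfl⟩
    have heq := Submodule.eq_of_le_of_finrank_eq hle h.symm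
    have hrow : ∀ i, ∃ c, c ᵥ* F = (F * A).row i := fun i => by
      have : (F * A).row i ∈ Submodule.span ℝ (Set.range F.row) := by
        rw [heq]
        exact Submodule.subset_span ⟨Sum.inl i, rfl⟩
      rw [← range_vecMulLinear] at this
      exact this
    choose N hN using hrow
    refine ⟨Matrix.of N, ?_⟩
    ext i j
    exact (congrFun (hN i) j).symm
  · rintro ⟨N, hN⟩
    apply le_antisymm
    · have : Matrix.fromRows (F * A) F = Matrix.fromRows N 1 * F := by
        rw [Matrix.fromRows_mul, hN, Matrix.one_mul]
      rw [this]
      exact Matrix.rank_mul_le_right _ _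
    · have : F = Matrix.fromCols (0 : Matrix (Fin r) (Fin r) ℝ) (1 : Matrix (Fin r) (Fin r) ℝ) *
          Matrix.fromRows (F * A) F := by
        rw [Matrix.fromCols_mul_fromRows, Matrix.zero_mul, Matrix.one_mul, zero_add]
      conv_lhs => rw [this]
      exact Matrix.rank_mul_le_right _ _

/-- The first block factors as `(s I - N) F`, and a right inverse cancels `F` in the left-kernel
equation. -/
theorem pencilRankCondition_iff (hF : F.rank = r) {N : Matrix (Fin r) (Fin r) ℝ}
    (hN : F * A = N * F) :
    PencilRankCondition A B F ↔ ∀ (s : ℂ) (v : Fin r → ℂ),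
      v ᵥ* N.map Complex.ofReal = s • v → v ᵥ* (F * B).map Complex.ofReal = 0 → v = 0 := by
  refine forall_congr' fun s => ?_
  obtain ⟨R, hR⟩ := exists_right_inverse_of_rank_eq hF
  have hRC : F.map Complex.ofReal * R.map Complex.ofReal = 1 := by
    have h1 : (F * R).map Complex.ofReal = F.map Complex.ofReal * R.map Complex.ofReal :=
      Matrix.map_mul (f := Complex.ofRealHom)
    rw [← h1, hR, Matrix.map_one _ Complex.ofReal_zero Complex.ofReal_one]
  rw [hF, rank_eq_iff_vecMul_injective]
  refine forall_congr' fun v => ?_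
  have hNF : (N * F).map Complex.ofReal = N.map Complex.ofReal * F.map Complex.ofReal :=
    Matrix.map_mul (f := Complex.ofRealHom)
  have h1 : s • F.map Complex.ofReal - (F * A).map Complex.ofReal =
      (s • (1 : Matrix (Fin r) (Fin r) ℂ) - N.map Complex.ofReal) * F.map Complex.ofReal := by
    rw [hN, hNF, Matrix.sub_mul, Matrix.smul_mul, Matrix.one_mul]
  have h2 : v ᵥ* ((s • (1 : Matrix (Fin r) (Fin r) ℂ) - N.map Complex.ofReal) *
      F.map Complex.ofReal) = 0 ↔ v ᵥ* N.map Complex.ofReal = s • v := by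
    rw [← Matrix.vecMul_vecMul]
    constructor
    · intro h
      have h3 := congrArg (fun w => w ᵥ* R.map Complex.ofReal) h
      simp only [Matrix.vecMul_vecMul, Matrix.zero_vecMul] at h3
      rw [Matrix.mul_assoc, hRC, Matrix.mul_one, Matrix.vecMul_sub, Matrix.vecMul_smul,
        Matrix.vecMul_one, sub_eq_zero] at h3
      exact h3.symm
    · intro h
      rw [Matrix.vecMul_sub, Matrix.vecMul_smul, Matrix.vecMul_one, h, sub_self,
        Matrix.zero_vecMul]
  rw [h1, Matrix.vecMul_fromCols]
  constructor
  · intro h h3 h4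
    refine h ?_
    rw [h2.2 h3, h4]
    ext (i | i) <;> rfl
  · intro h h3
    refine h (h2.1 ?_) ?_
    · ext i; exact congrFun h3 (Sum.inl i)
    · ext i; exact congrFun h3 (Sum.inr i)

/-- Hautus' test implies that no proper invariant subspace contains the range of the input
matrix. -/
theorem eq_top_of_hautus {N : Matrix (Fin r) (Fin r) ℝ} {G : Matrix (Fin r) (Fin m) ℝ}
    (h : ∀ (s : ℂ) (v : Fin r → ℂ),
      v ᵥ* N.map Complex.ofReal = s • v → v ᵥ* G.map Complex.ofReal = 0 → v = 0)
    (W : Submodule ℝ (Fin r → ℝ)) (hN : ∀ w ∈ W, N *ᵥ w ∈ W) (hG : ∀ u, G *ᵥ u ∈ W) : W = ⊤ := by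
  by_contra hW
  have hmap : ∀ {k : ℕ} (M : Matrix (Fin r) (Fin k) ℝ) (w : Fin k → ℝ),
      M.map Complex.ofReal *ᵥ (fun i => (w i : ℂ)) = fun i => ((M *ᵥ w) i : ℂ) := by
    intro k M w
    ext i
    simp [Matrix.mulVec, dotProduct]
  -- The complex annihilator of `W` is nonzero and stable under right multiplication by `N`, so it
  -- contains a left eigenvector, which kills `G`.
  let S : Submodule ℂ (Fin r → ℂ) :=
    { carrier := {v | ∀ w ∈ W, v ⬝ᵥ (fun i => (w i : ℂ)) = 0}
      zero_mem' := fun w _ => zero_dotProduct _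
      add_mem' := fun {a b} ha hb w hw => by rw [add_dotProduct, ha w hw, hb w hw, add_zero]
      smul_mem' := fun c a ha w hw => by rw [smul_dotProduct, ha w hw, smul_zero] }
  have hinv : ∀ v ∈ S, Matrix.vecMulLinear (N.map Complex.ofReal) v ∈ S := by
    intro v hv w hw
    rw [Matrix.vecMulLinear_apply, ← Matrix.dotProduct_mulVec, hmap]
    exact hv _ (hN w hw)
  have hS : Nontrivial S := by
    obtain ⟨f, hf, hfW⟩ := Submodule.exists_le_ker_of_lt_top W (lt_top_iff_ne_top.2 hW)
    rw [Submodule.nontrivial_iff_ne_bot, Submodule.ne_bot_iff]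
    refine ⟨fun i => (f (Pi.single i 1) : ℂ), fun w hw => ?_, fun h0 => hf ?_⟩
    · have h1 : f w = 0 := hfW hw
      rw [LinearMap.pi_apply_eq_sum_univ f w] at h1
      have h2 := congrArg Complex.ofReal h1
      rw [Complex.ofReal_sum, Complex.ofReal_zero] at h2
      rw [← h2]
      refine Finset.sum_congr rfl fun i _ => ?_
      have h3 : (fun j => if i = j then (1 : ℝ) else 0) = Pi.single i 1 := by
        ext j
        simp [Pi.single_apply, eq_comm]
      rw [h3, smul_eq_mul, Complex.ofReal_mul, mul_comm]
    · refine LinearMap.pi_ext' fun i => LinearMap.ext_ring ?_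
      have := congrFun h0 i
      simpa using this
  obtain ⟨s, hs⟩ := Module.End.exists_eigenvalue
    ((Matrix.vecMulLinear (N.map Complex.ofReal)).restrict hinv)
  obtain ⟨v, hv⟩ := hs.exists_hasEigenvector
  have hv1 : (v : Fin r → ℂ) ᵥ* N.map Complex.ofReal = s • (v : Fin r → ℂ) :=
    congrArg Subtype.val hv.apply_eq_smul
  refine hv.2 (Subtype.ext (h s v hv1 ?_))
  ext j
  have h1 := v.2 _ (hG (Pi.single j 1))
  rw [← hmap, Matrix.dotProduct_mulVec] at h1
  have h2 : (fun i => ((Pi.single j (1 : ℝ) : Fin m → ℝ) i : ℂ)) = Pi.single j 1 := by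
    ext i
    by_cases hij : i = j
    · subst hij; simp
    · simp [hij]
  rw [h2, dotProduct_single_one] at h1
  exact h1

/-! ### Closed-loop subsystems and their poles -/

theorem exists_isClosedLoopSolution (A : Matrix (Fin n) (Fin n) ℝ) (B : Matrix (Fin n) (Fin m) ℝ)
    (F : Matrix (Fin r) (Fin n) ℝ) (Z : Matrix (Fin m) (Fin r) ℝ) (x₀ : Fin n → ℝ) :
    ∃ x, IsClosedLoopSolution A B F Z 0 x ∧ x 0 = x₀ := by
  let L : (Fin n → ℝ) →L[ℝ] (Fin n → ℝ) :=
    LinearMap.toContinuousLinearMap (Matrix.mulVecLin (A - B * (Z * F)))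
  refine ⟨fun t => NormedSpace.exp (t • L) x₀, fun t _ => ?_, by simp⟩
  have h := (hasDerivAt_exp_smul_const' L t).clm_apply (hasDerivAt_const t x₀)
  refine (h.congr_deriv ?_).hasDerivWithinAt
  simp [L, Matrix.mulVec_neg, sub_eq_add_neg, Matrix.mulVec_mulVec]

theorem hasDerivWithinAt_mulVec {k : ℕ} (F : Matrix (Fin k) (Fin n) ℝ) {x : ℝ → Fin n → ℝ}
    {x' : Fin n → ℝ} {S : Set ℝ} {t : ℝ} (h : HasDerivWithinAt x x' S t) :
    HasDerivWithinAt (fun τ => F *ᵥ x τ) (F *ᵥ x') S t :=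
  (LinearMap.toContinuousLinearMap (Matrix.mulVecLin F)).hasFDerivAt.comp_hasDerivWithinAt t h

theorem isClosedLoopSubsystem_iff {Z : Matrix (Fin m) (Fin r) ℝ} {M : Matrix (Fin r) (Fin r) ℝ} :
    IsClosedLoopSubsystem A B F Z M ↔ F * A = (M + F * B * Z) * F := by
  have key : ∀ y : Fin n → ℝ, F *ᵥ (A *ᵥ y + B *ᵥ (-(Z *ᵥ (F *ᵥ y)))) =
      (F * A - F * B * Z * F) *ᵥ y := by
    intro y
    rw [Matrix.sub_mulVec, sub_eq_add_neg]
    simp [Matrix.mulVec_add, Matrix.mulVec_neg, Matrix.mulVec_mulVec, Matrix.mul_assoc]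
  constructor
  · intro h
    rw [Matrix.add_mul, ← sub_eq_iff_eq_add, Matrix.ext_iff_mulVec]
    intro x₀
    obtain ⟨x, hx, rfl⟩ := exists_isClosedLoopSolution A B F Z x₀
    have h1 := h 0 x hx 0 Set.self_mem_Ici
    have h2 := hasDerivWithinAt_mulVec F (hx 0 Set.self_mem_Ici)
    rw [key] at h2
    rw [(uniqueDiffOn_Ici (0 : ℝ) 0 Set.self_mem_Ici).eq_deriv _ h2 h1, Matrix.mulVec_mulVec]
  · intro h t₀ x hx t ht
    have h2 := hasDerivWithinAt_mulVec F (hx t ht)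
    rw [key, h, Matrix.add_mul, add_sub_cancel_right, ← Matrix.mulVec_mulVec] at h2
    exact h2

theorem isClosedLoopSubsystem_sub {N : Matrix (Fin r) (Fin r) ℝ} (hN : F * A = N * F)
    (Z : Matrix (Fin m) (Fin r) ℝ) : IsClosedLoopSubsystem A B F Z (N - F * B * Z) := by
  rw [isClosedLoopSubsystem_iff, sub_add_cancel, hN]

theorem mem_poles_of_vecMul_eq {M : Matrix (Fin r) (Fin r) ℝ} {s : ℂ} {v : Fin r → ℂ} (hv : v ≠ 0)
    (h : v ᵥ* M.map Complex.ofReal = s • v) : s ∈ poles M := by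
  rw [poles, Polynomial.mem_roots (Matrix.charpoly_monic _).ne_zero, Polynomial.IsRoot,
    Matrix.eval_charpoly, ← Matrix.exists_vecMul_eq_zero_iff]
  refine ⟨v, hv, ?_⟩
  rw [Matrix.vecMul_sub, h, Matrix.scalar_apply, Matrix.vecMul_diagonal_const, op_smul_eq_smul, sub_self]

/-- If no complex number is a pole of every subsystem obtained by feedback, then both rank
conditions hold. -/
theorem rankConditions_of_avoids_poles (hF : F.rank = r)
    (h : ∀ s : ℂ, ∃ (Z : Matrix (Fin m) (Fin r) ℝ) (M : Matrix (Fin r) (Fin r) ℝ),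
      IsClosedLoopSubsystem A B F Z M ∧ s ∉ poles M) :
    InvarianceRankCondition A F ∧ PencilRankCondition A B F := by
  obtain ⟨Z₀, M₀, h₀, -⟩ := h 0
  have hN := isClosedLoopSubsystem_iff.1 h₀
  refine ⟨invarianceRankCondition_iff.2 ⟨_, hN⟩, ?_⟩
  rw [pencilRankCondition_iff hF hN]
  intro s v hv hvB
  by_contra hv0
  obtain ⟨Z, M, hM, hs⟩ := h s
  refine hs (mem_poles_of_vecMul_eq hv0 ?_)
  obtain ⟨R, hR⟩ := exists_right_inverse_of_rank_eq hF
  -- Both sides are the unique `N`; since `v` kills `F * B`, it is a left eigenvector of `M` too.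
  have heq : M₀ + F * B * Z₀ = M + F * B * Z := by
    have h1 := congrArg (· * R) (hN.symm.trans (isClosedLoopSubsystem_iff.1 hM))
    simpa only [Matrix.mul_assoc, hR, Matrix.mul_one] using h1
  have hmap : (M + F * B * Z).map Complex.ofReal =
      M.map Complex.ofReal + (F * B).map Complex.ofReal * Z.map Complex.ofReal := by
    rw [Matrix.map_add _ Complex.ofReal_add]
    congr 1
    exact Matrix.map_mul (f := Complex.ofRealHom)
  rw [heq, hmap, Matrix.vecMul_add, ← Matrix.vecMul_vecMul, hvB, Matrix.zero_vecMul,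
    add_zero] at hv
  exact hv

theorem poles_eq_of_charpoly_map {M : Matrix (Fin r) (Fin r) ℝ} {Λ : Multiset ℂ}
    (h : M.charpoly.map Complex.ofRealHom = (Λ.map fun a => Polynomial.X - Polynomial.C a).prod) :
    poles M = Λ := by
  have : (M.map Complex.ofReal).charpoly = M.charpoly.map Complex.ofRealHom :=
    Matrix.charpoly_map M Complex.ofRealHom
  rw [poles, this, h, Polynomial.roots_multiset_prod_X_sub_C]

/-- Conjugation permutes the linear factors, so it fixes every coefficient of the product. -/
theorem exists_real_polynomial_of_map_conj {Λ : Multiset ℂ} (hΛ : Λ.map (starRingEnd ℂ) = Λ) :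
    ∃ p : Polynomial ℝ, p.Monic ∧ p.natDegree = Multiset.card Λ ∧
      p.map Complex.ofRealHom = (Λ.map fun a => Polynomial.X - Polynomial.C a).prod := by
  set P : Polynomial ℂ := (Λ.map fun a => Polynomial.X - Polynomial.C a).prod with hP
  have hconj : P.map (starRingEnd ℂ) = P := by
    rw [hP, Polynomial.map_multiset_prod, Multiset.map_map]
    conv_rhs => rw [← hΛ, Multiset.map_map]
    congr 2
    ext1 a
    simp
  have hPm : P.Monic := Polynomial.monic_multiset_prod_of_monic _ _
    fun a _ => Polynomial.monic_X_sub_C a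
  have hlift : P ∈ Polynomial.lifts Complex.ofRealHom := by
    rw [Polynomial.lifts_iff_coeff_lifts]
    intro k
    have := congrArg (fun Q => Q.coeff k) hconj
    simp only [Polynomial.coeff_map] at this
    obtain ⟨a, ha⟩ := Complex.conj_eq_iff_real.1 this
    exact ⟨a, ha.symm⟩
  obtain ⟨p, hp, hpd, hpm⟩ := Polynomial.lifts_and_natDegree_eq_and_monic hlift hPm
  exact ⟨p, hpm, by rw [hpd, hP, Polynomial.natDegree_multiset_prod_X_sub_C_eq_card], hp⟩

theorem exists_isClosedLoopSubsystem_charpoly_eq (hF : F.rank = r)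
    (ha : InvarianceRankCondition A F) (hb : PencilRankCondition A B F)
    {p : Polynomial ℝ} (hp : p.Monic) (hpr : p.natDegree = r) :
    ∃ (Z : Matrix (Fin m) (Fin r) ℝ) (M : Matrix (Fin r) (Fin r) ℝ),
      IsClosedLoopSubsystem A B F Z M ∧ M.charpoly = p := by
  obtain ⟨N, hN⟩ := invarianceRankCondition_iff.1 ha
  obtain ⟨Z, hZ⟩ := exists_charpoly_sub_mul_eq
    (eq_top_of_hautus ((pencilRankCondition_iff hF hN).1 hb)) hp hpr
  exact ⟨Z, _, isClosedLoopSubsystem_sub hN Z, hZ⟩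

/-! ### Exponential decay -/

/-- A real matrix whose characteristic polynomial has distinct real roots is diagonalizable. -/
theorem exists_mul_eq_diagonal_mul {M : Matrix (Fin r) (Fin r) ℝ} {d : Fin r → ℝ}
    (hd : Function.Injective d)
    (hM : M.charpoly = ∏ i, (Polynomial.X - Polynomial.C (d i))) :
    ∃ P : Matrix (Fin r) (Fin r) ℝ, IsUnit P ∧ P * M = Matrix.diagonal d * P := by
  have hroot : ∀ i, ∃ v : Fin r → ℝ, v ≠ 0 ∧ v ᵥ* M = d i • v := by
    intro i
    have h1 : M.charpoly.eval (d i) = 0 := by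
      rw [hM, Polynomial.eval_prod]
      exact Finset.prod_eq_zero (Finset.mem_univ i) (by simp)
    rw [Matrix.eval_charpoly, ← Matrix.exists_vecMul_eq_zero_iff] at h1
    obtain ⟨v, hv, h⟩ := h1
    refine ⟨v, hv, ?_⟩
    rw [Matrix.vecMul_sub, Matrix.scalar_apply, Matrix.vecMul_diagonal_const, op_smul_eq_smul,
      sub_eq_zero] at h
    exact h.symm
  choose v hv0 hv using hroot
  have hli : LinearIndependent ℝ v :=
    Module.End.eigenvectors_linearIndependent' (Matrix.vecMulLinear M) d hd v fun i =>
      ⟨Module.End.mem_eigenspace_iff.2 (hv i), hv0 i⟩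
  refine ⟨Matrix.of v, Matrix.linearIndependent_rows_iff_isUnit.1 hli, ?_⟩
  ext i j
  rw [Matrix.diagonal_mul]
  exact congrFun (hv i) j

/-- The integrating factor makes the product constant. -/
theorem eq_exp_mul_of_hasDerivWithinAt {w : ℝ → ℝ} {d t₀ : ℝ}
    (hw : ∀ t ∈ Set.Ici t₀, HasDerivWithinAt w (d * w t) (Set.Ici t₀) t) {t : ℝ} (ht : t₀ ≤ t) :
    w t = Real.exp (d * (t - t₀)) * w t₀ := by
  let g : ℝ → ℝ := fun t => Real.exp (-(d * (t - t₀))) * w t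
  have hg : ∀ t ∈ Set.Ici t₀, HasDerivWithinAt g 0 (Set.Ici t₀) t := by
    intro s hs
    have h1 : HasDerivAt (fun t => Real.exp (-(d * (t - t₀)))) (Real.exp (-(d * (s - t₀))) *
        -(d * 1)) s := (((hasDerivAt_id s).sub_const t₀).const_mul d).neg.exp
    refine (h1.hasDerivWithinAt.mul (hw s hs)).congr_deriv ?_
    ring
  have hconst := constant_of_has_deriv_right_zero (f := g) (a := t₀) (b := t)
    (fun s hs => ((hg s hs.1).continuousWithinAt).mono Set.Icc_subset_Ici_self)
    (fun s hs => (hg s hs.1).mono (Set.Ici_subset_Ici.2 hs.1)) t ⟨ht, le_rfl⟩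
  have h2 : Real.exp (-(d * (t - t₀))) * w t = w t₀ := by simpa [g] using hconst
  rw [← h2, ← mul_assoc, ← Real.exp_add, add_neg_cancel, Real.exp_zero, one_mul]

/-- A subsystem with distinct real poles to the left of `-ρ` converges at rate `ρ`. -/
theorem convergesAtRate_of_charpoly_eq {Z : Matrix (Fin m) (Fin r) ℝ}
    {M : Matrix (Fin r) (Fin r) ℝ} (hM : IsClosedLoopSubsystem A B F Z M) {d : Fin r → ℝ}
    (hd : Function.Injective d)
    (hMd : M.charpoly = ∏ i, (Polynomial.X - Polynomial.C (d i))) {ρ : ℝ} (hρ : 0 < ρ)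
    (hdρ : ∀ i, d i ≤ -ρ) : ConvergesAtRate A B F Z ρ := by
  obtain ⟨P, hP, hPM⟩ := exists_mul_eq_diagonal_mul hd hMd
  -- The coordinates `P z` decouple; the constant `‖L'‖ * ‖L‖` is independent of `t₀` and of the
  -- solution.
  let L := LinearMap.toContinuousLinearMap (Matrix.mulVecLin P)
  let L' := LinearMap.toContinuousLinearMap (Matrix.mulVecLin P⁻¹)
  have hL' : ∀ z, L' (P *ᵥ z) = z := fun z => by
    simp [L', Matrix.mulVec_mulVec, Matrix.nonsing_inv_mul P ((Matrix.isUnit_iff_isUnit_det P).1 hP)]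
  have hbound : ∀ (t₀ : ℝ) (x : ℝ → Fin n → ℝ), IsClosedLoopSolution A B F Z t₀ x →
      ∀ t ∈ Set.Ici t₀,
        ‖F *ᵥ x t‖ ≤ ‖L'‖ * ‖L‖ * Real.exp (-ρ * (t - t₀)) * ‖F *ᵥ x t₀‖ := by
    intro t₀ x hx t ht
    have hsol : ∀ i, (P *ᵥ (F *ᵥ x t)) i =
        Real.exp (d i * (t - t₀)) * (P *ᵥ (F *ᵥ x t₀)) i := by
      intro i
      refine eq_exp_mul_of_hasDerivWithinAt (w := fun τ => (P *ᵥ (F *ᵥ x τ)) i)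
        (fun s hs => ?_) ht
      have h1 := hasDerivWithinAt_pi.1 (hasDerivWithinAt_mulVec P (hM t₀ x hx s hs)) i
      rw [Matrix.mulVec_mulVec, hPM, ← Matrix.mulVec_mulVec, Matrix.mulVec_diagonal] at h1
      exact h1
    have hw : ‖P *ᵥ (F *ᵥ x t)‖ ≤ Real.exp (-ρ * (t - t₀)) * ‖P *ᵥ (F *ᵥ x t₀)‖ := by
      refine (pi_norm_le_iff_of_nonneg (by positivity)).2 fun i => ?_
      rw [hsol, norm_mul, Real.norm_of_nonneg (Real.exp_pos _).le]
      have h0 : 0 ≤ t - t₀ := sub_nonneg.2 ht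
      have := hdρ i
      gcongr
      exact norm_le_pi_norm (P *ᵥ (F *ᵥ x t₀)) i
    calc ‖F *ᵥ x t‖ = ‖L' (P *ᵥ (F *ᵥ x t))‖ := by rw [hL']
      _ ≤ ‖L'‖ * ‖P *ᵥ (F *ᵥ x t)‖ := L'.le_opNorm _
      _ ≤ ‖L'‖ * (Real.exp (-ρ * (t - t₀)) * (‖L‖ * ‖F *ᵥ x t₀‖)) := by
        gcongr
        refine hw.trans ?_
        gcongr
        exact L.le_opNorm _
      _ = _ := by ring
  refine ⟨‖L'‖ * ‖L‖, fun t₀ x hx => ⟨?_, hbound t₀ x hx⟩⟩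
  rw [tendsto_zero_iff_norm_tendsto_zero]
  refine squeeze_zero' (Eventually.of_forall fun _ => norm_nonneg _)
    ((eventually_ge_atTop t₀).mono fun t ht => hbound t₀ x hx t ht) ?_
  have hlin : Tendsto (fun t : ℝ => -ρ * (t - t₀)) atTop atBot :=
    (tendsto_atTop_add_const_right atTop (-t₀) tendsto_id).const_mul_atTop_of_neg
      (neg_lt_zero.2 hρ)
  simpa using ((Real.tendsto_exp_atBot.comp hlin).const_mul (‖L'‖ * ‖L‖)).mul_const ‖F *ᵥ x t₀‖

theorem drivesAtArbitraryRate_of_rankConditions (hF : F.rank = r)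
    (ha : InvarianceRankCondition A F) (hb : PencilRankCondition A B F) :
    DrivesAtArbitraryRate A B F := by
  intro ρ hρ
  -- Distinct poles make `M` diagonalizable, so no polynomial factor spoils the rate `ρ`.
  let d : Fin r → ℝ := fun i => -(ρ + 1 + (i : ℕ))
  have hd : Function.Injective d := fun i j hij => by
    simpa [d, Fin.ext_iff] using hij
  have hdρ : ∀ i, d i < -ρ := fun i => by
    have : (0 : ℝ) ≤ (i : ℕ) := Nat.cast_nonneg _
    simp only [d]
    linarith
  obtain ⟨Z, M, hM, hMd⟩ := exists_isClosedLoopSubsystem_charpoly_eq hF ha hb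
    (Polynomial.monic_prod_of_monic Finset.univ _ fun i _ => Polynomial.monic_X_sub_C (d i))
    (by rw [Polynomial.natDegree_finsetProd_X_sub_C_eq_card]; simp)
  refine ⟨Z, M, hM, ?_, convergesAtRate_of_charpoly_eq hM hd hMd hρ fun i => (hdρ i).le⟩
  have hpoles : poles M = Finset.univ.val.map fun i => (d i : ℂ) := by
    apply poles_eq_of_charpoly_map
    rw [hMd, Polynomial.map_prod, Multiset.map_map]
    simp [Finset.prod]
  rw [hpoles]
  intro μ hμ
  obtain ⟨i, -, rfl⟩ := Multiset.mem_map.1 hμ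
  simpa using hdρ i

theorem polesPlaceable_of_rankConditions (hF : F.rank = r)
    (ha : InvarianceRankCondition A F) (hb : PencilRankCondition A B F) :
    PolesPlaceable A B F := by
  intro Λ hcard hconj
  obtain ⟨p, hp, hpd, hpΛ⟩ := exists_real_polynomial_of_map_conj hconj
  obtain ⟨Z, M, hM, rfl⟩ := exists_isClosedLoopSubsystem_charpoly_eq hF ha hb hp (hpd.trans hcard)
  exact ⟨Z, M, hM, poles_eq_of_charpoly_map hpΛ⟩

end TargetOutput

theorem theorem3 {n m r : ℕ} (A : Matrix (Fin n) (Fin n) ℝ) (B : Matrix (Fin n) (Fin m) ℝ)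
    (F : Matrix (Fin r) (Fin n) ℝ) (hF : F.rank = r) :
    (TargetOutput.DrivesAtArbitraryRate A B F ↔
      TargetOutput.InvarianceRankCondition A F ∧ TargetOutput.PencilRankCondition A B F) ∧
    (TargetOutput.PolesPlaceable A B F ↔
      TargetOutput.InvarianceRankCondition A F ∧ TargetOutput.PencilRankCondition A B F) ∧
    (TargetOutput.InvarianceRankCondition A F →
      ∀ Fg : Matrix (Fin n) (Fin r) ℝ, F * Fg * F = F →
        ∀ Z : Matrix (Fin m) (Fin r) ℝ,
          TargetOutput.IsClosedLoopSubsystem A B F Z (F * A * Fg - F * B * Z)) := by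
  refine ⟨⟨fun h => ?_, fun h => TargetOutput.drivesAtArbitraryRate_of_rankConditions hF h.1 h.2⟩,
    ⟨fun h => ?_, fun h => TargetOutput.polesPlaceable_of_rankConditions hF h.1 h.2⟩, ?_⟩
  · refine TargetOutput.rankConditions_of_avoids_poles hF fun s => ?_
    -- This rate forces every pole to the left of `s`.
    obtain ⟨Z, M, hM, hpoles, -⟩ := h (‖s‖ + 1) (by positivity)
    refine ⟨Z, M, hM, fun hs => ?_⟩
    have h1 := hpoles s hs
    have h2 := neg_le_of_abs_le (Complex.abs_re_le_norm s)
    linarith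
  · refine TargetOutput.rankConditions_of_avoids_poles hF fun s => ?_
    -- A repeated real pole is self-conjugate, and this one lies to the right of `s`.
    obtain ⟨Z, M, hM, hpoles⟩ := h (Multiset.replicate r ((‖s‖ + 1 : ℝ) : ℂ)) (by simp)
      (by rw [Multiset.map_replicate, Complex.conj_ofReal])
    refine ⟨Z, M, hM, fun hs => ?_⟩
    rw [hpoles] at hs
    have h1 := congrArg Complex.re (Multiset.eq_of_mem_replicate hs)
    rw [Complex.ofReal_re] at h1
    have h2 := Complex.re_le_norm s
    linarith
  · intro ha Fg hFg Z
    obtain ⟨N, hN⟩ := TargetOutput.invarianceRankCondition_iff.1 ha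
    refine TargetOutput.isClosedLoopSubsystem_sub ?_ Z
    -- `F * A * Fg` serves as `N`, because `N * (F * Fg * F) = N * F`.
    rw [hN, Matrix.mul_assoc N, Matrix.mul_assoc N, hFg]
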